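/- Let $\mathcal Z\subset\mathbb R^d$ be the range of an observed auction-specific instrument $z$. Consider the following first-price auction with entry costs. \emph{Primitives.} There are $\overline n$ potential buyers. They draw i.i.d. signals $S_i$, uniform on $[0,1]$; given $S_i=s$, the private value $V_i$ has c.d.f. $F(\cdot|s)$, independently across buyers. A buyer who enters pays $c(z)$. Assume (Assumption E): $\overline n\ge 2$; for every $s\in[0,1]$ the support of $F(\cdot|s)$ is $[\underline v,\overline v]$ with $\underline v<\overline v$; $F(\cdot|\cdot)$ is continuous on $[\underline v,\overline v]\times[0,1]$, with a density $f(\cdot|\cdot)$ continuous and bounded away from $0$ on this set; for each $v$, $F(v|s)$ is nonincreasing in $s\in[0,1]$; $c$ is continuous and non-constant on $\mathcal Z$; and $\mathcal Z$ is closed and connected with non-empty interior. None of $\overline n$, $F$ depends on $z$. \emph{Equilibrium.} A buyer enters iff $S_i\ge s(z)$. For a threshold $s\in(0,1)$, let $F_c(v|s)=\frac1{1-s}\int_s^1F(v|t)\,dt=\mathbb P(V_i\le v|S_i\ge s)$ be the value c.d.f. of an entrant, and $V_c(\cdot|s)$ its quantile function. Assume $0<s(z)<1$ for all $z\in\mathcal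 Z$, and that $s(z)$ solves the break-even condition $$c(z)=\int_0^{\overline v}\bigl[1-F(v|s(z))\bigr]\bigl[s(z)+(1-s(z))F_c(v|s(z))\bigr]^{\overline n-1}dv .$$ Entrants do not observe the number $N_c$ of entrants. An entrant with value $V_i$ bids $B_c(A_i|z)$, $A_i=F_c(V_i|s(z))$, where $B_c(\cdot|z)$ is strictly increasing on $[0,1]$ with $B_c(0|z)=\underline v$ and is a symmetric best response: for each $\alpha\in[0,1]$, $a=\alpha$ maximizes over $a\in[0,1]$ the product of $V_c(\alpha|s(z))-B_c(a|z)$ and the probability that none of the $\overline n-1$ other buyers enters and bids more than $B_c(a|z)$. \emph{Observables.} The analyst does not observe $N_c$, but knows for each $z\in\mathcal Z$ the outcome distribution $\mathbb G(\cdot|z)$, i.e. the probability $\mathbb G(\text{Not sold}|z)$ that nobody enters and the probabilities $\mathbb G(W\le b|z)$, $b\in\mathbb R$, that the object is sold at a winning bid $W\le b$, where $W$ is the largest of the entrants' bids. \emph{Claim.} Suppose that the maximal bid $B_c(1|z)$ is not constant over $z\in\mathcal Z$. Then $\overline n$, $\{s(z),z\in\mathcal Z\}$, $\{F(\cdot|s),s\in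 s(\mathcal Z)\}$ and $\{c(z),z\in\mathcal Z\}$ are identified from $\{\mathbb G(\cdot|z),z\in\mathcal Z\}$: if another model of this kind, with $\overline n'$, $F'$, $c'$, $s'$, has the same outcome distributions for all $z\in\mathcal Z$, then $\overline n'=\overline n$, $s'(z)=s(z)$ and $c'(z)=c(z)$ for all $z\in\mathcal Z$, and $F'(\cdot|s)=F(\cdot|s)$ for all $s\in s(\mathcal Z)$. -/

import Mathlib

open Set MeasureTheory ProbabilityTheory

noncomputable section

/-- The ingredients of a first-price auction with entry costs indexed by an observed
instrument `z ∈ ℝ^d`. -/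
structure EntryModel (d : ℕ) where
  /-- number of potential entrants -/
  nbar : ℕ
  /-- lower end of the support of private values -/
  vlo : ℝ
  /-- upper end of the support of private values -/
  vhi : ℝ
  /-- `valueLaw s` is the law of a buyer's private value given that her signal is `s`
  (only `s ∈ [0,1]` matters) -/
  valueLaw : Kernel ℝ ℝ
  isMarkov : IsMarkovKernel valueLaw
  /-- entry cost `c(z)` -/
  cost : EuclideanSpace ℝ (Fin d) → ℝ
  /-- signal threshold `s(z)`: a buyer enters iff her signal is at least `s(z)` -/
  threshold : EuclideanSpace ℝ (Fin d) → ℝ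
  /-- `bid z α`: bid `B_c(α|z)` of an entrant whose private value has level `α ∈ [0,1]` in the
  distribution of entrants' private values; it is also the bid quantile function -/
  bid : EuclideanSpace ℝ (Fin d) → ℝ → ℝ

namespace EntryModel

attribute [instance] EntryModel.isMarkov

variable {d : ℕ} (M : EntryModel d)

/-- Conditional c.d.f. `F(v|s)` of a private value given the signal. -/
def F (v s : ℝ) : ℝ := cdf (M.valueLaw s) v

/-- C.d.f. `F_c(v|s) = P(V ≤ v | S ≥ s)` of the private value of an entrant when the entry
threshold is `s`. -/
def Fc (v s : ℝ) : ℝ := 1 / (1 - s) * ∫ t in s..1, M.F v t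

/-- Quantile function `V_c(α|s)` of `F_c(·|s)`. -/
def Vc (α s : ℝ) : ℝ := sInf {v | M.vlo ≤ v ∧ α ≤ M.Fc v s}

/-- First-stage expected profit `Π(S;s)`, gross of the entry cost, of a buyer with signal `S`
when her competitors use the entry threshold `s`. -/
def expectedProfit (S s : ℝ) : ℝ :=
  ∫ v in (0 : ℝ)..M.vhi, (1 - M.F v S) * (s + (1 - s) * M.Fc v s) ^ (M.nbar - 1)

/-- Joint law of the signal and the private value of one buyer: the signal is uniform on `[0,1]`
and the value is drawn from `F(·|S)`. -/
def buyerLaw : Measure (ℝ × ℝ) := (volume.restrict (Icc (0 : ℝ) 1)) ⊗ₘ M.valueLaw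

/-- Joint law of the signals and values of `m` independent buyers. -/
def buyersLaw (m : ℕ) : Measure (Fin m → ℝ × ℝ) := Measure.pi fun _ => M.buyerLaw

/-- Bid of an entrant with private value `v`. -/
def bidOfValue (z : EuclideanSpace ℝ (Fin d)) (v : ℝ) : ℝ :=
  M.bid z (M.Fc v (M.threshold z))

/-- Probability that the bid `B_c(a|z)` beats the `nbar - 1` competitors, each of whom enters iff
her signal is at least the threshold. -/
def winProb (z : EuclideanSpace ℝ (Fin d)) (a : ℝ) : ℝ :=
  (M.buyersLaw (M.nbar - 1)).real
    {ω | ∀ j, M.threshold z ≤ (ω j).1 → M.bidOfValue z (ω j).2 ≤ M.bid z a}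

open Classical in
/-- Outcome of the auction given the signals and values of the potential entrants: `⊥` if the
object is not sold (nobody enters), the winning bid otherwise. -/
def outcome (z : EuclideanSpace ℝ (Fin d)) (ω : Fin M.nbar → ℝ × ℝ) : WithBot ℝ :=
  (Finset.univ.filter fun i => M.threshold z ≤ (ω i).1).sup
    fun i => ((M.bidOfValue z (ω i).2 : ℝ) : WithBot ℝ)

/-- Probability `𝔾(Not sold | z)`. -/
def probNotSold (z : EuclideanSpace ℝ (Fin d)) : ℝ :=
  (M.buyersLaw M.nbar).real {ω | M.outcome z ω = ⊥}

/-- Probability `𝔾(Sold, W ≤ b | z)`. -/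
def probSoldAtMost (z : EuclideanSpace ℝ (Fin d)) (b : ℝ) : ℝ :=
  (M.buyersLaw M.nbar).real {ω | M.outcome z ω ≠ ⊥ ∧ M.outcome z ω ≤ (b : WithBot ℝ)}

/-- Conditions on the primitives: number of potential entrants, value distribution, cost function
and range `Z` of the instrument. -/
structure AssumptionE (Z : Set (EuclideanSpace ℝ (Fin d))) : Prop where
  two_le_nbar : 2 ≤ M.nbar
  vlo_lt_vhi : M.vlo < M.vhi
  /-- `F(·|s)` has a density on `[vlo, vhi]` which is jointly continuous and bounded away
  from `0`. -/
  density : ∃ f : ℝ → ℝ → ℝ,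
    ContinuousOn (fun p : ℝ × ℝ => f p.1 p.2) (Icc M.vlo M.vhi ×ˢ Icc (0 : ℝ) 1) ∧
    (∃ δ > 0, ∀ v ∈ Icc M.vlo M.vhi, ∀ s ∈ Icc (0 : ℝ) 1, δ ≤ f v s) ∧
    ∀ s ∈ Icc (0 : ℝ) 1, M.valueLaw s =
      (volume.restrict (Icc M.vlo M.vhi)).withDensity fun v => ENNReal.ofReal (f v s)
  F_continuousOn :
    ContinuousOn (fun p : ℝ × ℝ => M.F p.1 p.2) (Icc M.vlo M.vhi ×ˢ Icc (0 : ℝ) 1)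
  F_antitone : ∀ v ∈ Icc M.vlo M.vhi, AntitoneOn (fun s => M.F v s) (Icc 0 1)
  cost_continuousOn : ContinuousOn M.cost Z
  cost_nonconstant : ∃ z₁ ∈ Z, ∃ z₂ ∈ Z, M.cost z₁ ≠ M.cost z₂
  Z_closed : IsClosed Z
  Z_connected : IsConnected Z
  Z_interior : (interior Z).Nonempty

/-- Equilibrium of the two-stage game when entrants do not observe how many buyers entered: the
threshold lies in `(0,1)` and satisfies the break-even condition, and bidding `B_c(·|z)` is a
symmetric increasing best response starting at the lowest value. -/
structure IsEquilibrium (Z : Set (EuclideanSpace ℝ (Fin d))) : Prop where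
  threshold_mem : ∀ z ∈ Z, M.threshold z ∈ Ioo (0 : ℝ) 1
  break_even : ∀ z ∈ Z, M.cost z = M.expectedProfit (M.threshold z) (M.threshold z)
  bid_strictMono : ∀ z ∈ Z, StrictMonoOn (M.bid z) (Icc 0 1)
  bid_zero : ∀ z ∈ Z, M.bid z 0 = M.vlo
  best_response : ∀ z ∈ Z, ∀ α ∈ Icc (0 : ℝ) 1, ∀ a ∈ Icc (0 : ℝ) 1,
    (M.Vc α (M.threshold z) - M.bid z a) * M.winProb z a ≤
      (M.Vc α (M.threshold z) - M.bid z α) * M.winProb z α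

/-- Two models generate the same conditional outcome distributions given `z`, for all `z ∈ Z`
(the events `{Not sold}` and `{Sold, W ≤ b}` determine the outcome distribution). -/
def SameOutcomes (M M' : EntryModel d) (Z : Set (EuclideanSpace ℝ (Fin d))) : Prop :=
  ∀ z ∈ Z, M.probNotSold z = M'.probNotSold z ∧
    ∀ b : ℝ, M.probSoldAtMost z b = M'.probSoldAtMost z b

end EntryModel

end

namespace EntryModel

variable {d : ℕ} {M : EntryModel d} {Z : Set (EuclideanSpace ℝ (Fin d))}

/-! ### Value distributions conditional on the signal. -/

section Cdf

/-! Write n for `nbar`, s for the threshold at z. The probability that no buyer bids above b is the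
n-th power of a one-buyer probability, which equals s + (1-s)a at the bid of level a. Index bids by
t = (s + (1-s)a)^n ∈ [s^n, 1]. Then Q(t), the bid at that level, is the quantile function of the
winning bid. Both the interval, whose left end is the probability of no sale, and Q are observable.

A bid of index t beats the n-1 competitors with probability t^(1-1/n), so optimality gives Q'(t) =
(V(t) - Q(t))(1-1/n)/t, where V(t) is the bidder's value. Hence (V - Q)(1-1/n) is observable
(`markup_eq`). At t = 1 the value is `vhi` for every z; subtracting the equations for two z with
different maximal bids removes `vhi` and reveals n (`nbar_eq`).

Once n is known, s is the n-th root of the no-sale probability and V gives the entrants' c.d.f.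
`Fc`, hence ∫_s^1 F(v|t) dt for every s in the range of the threshold. That range is a nondegenerate
interval: the marginal entrant's profit is strictly increasing in s and equals the continuous,
nonconstant cost. Differentiating in s recovers F, and break-even then gives the cost. -/

theorem F_eq_real (v s : ℝ) : M.F v s = (M.valueLaw s).real (Iic v) :=
  cdf_eq_real _ _

theorem F_nonneg (v s : ℝ) : 0 ≤ M.F v s := cdf_nonneg _ _

theorem F_le_one (v s : ℝ) : M.F v s ≤ 1 := cdf_le_one _ _

theorem F_mono (s : ℝ) : Monotone fun v => M.F v s := (cdf (M.valueLaw s)).mono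

theorem measurable_F (v : ℝ) : Measurable (M.F v) := by
  have h : M.F v = fun s => (M.valueLaw s (Iic v)).toReal := by
    funext s; rw [F_eq_real]; rfl
  rw [h]
  exact (Kernel.measurable_coe _ measurableSet_Iic).ennreal_toReal

theorem intervalIntegrable_F (v a b : ℝ) : IntervalIntegrable (M.F v) volume a b := by
  refine (intervalIntegrable_const (c := (1 : ℝ))).mono_fun
    (measurable_F v).aestronglyMeasurable ?_
  refine Filter.Eventually.of_forall fun t => ?_
  simp [abs_of_nonneg (F_nonneg v t), F_le_one]

theorem F_sub_eq {v v' : ℝ} (h : v ≤ v') (s : ℝ) :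
    M.F v' s - M.F v s = (M.valueLaw s).real (Ioc v v') := by
  have hdiff : Ioc v v' = Iic v' \ Iic v := by
    ext x; simp [and_comm]
  rw [F_eq_real, F_eq_real, hdiff, measureReal_sdiff (Iic_subset_Iic.2 h) measurableSet_Iic]

/-- The density is bounded by compactness and vanishes off the support. The constant is uniform in
s, so it survives averaging into `Fc`. -/
theorem AssumptionE.exists_F_sub_le (hE : M.AssumptionE Z) :
    ∃ C : ℝ, 0 ≤ C ∧ ∀ s ∈ Icc (0 : ℝ) 1, ∀ v v', v ≤ v' →
      M.F v' s - M.F v s ≤ C * (v' - v) := by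
  obtain ⟨f, hf, -, hlaw⟩ := hE.density
  obtain ⟨C, hC⟩ := (isCompact_Icc.prod isCompact_Icc).exists_bound_of_continuousOn hf
  refine ⟨max C 0, le_max_right _ _, fun s hs v v' hv => ?_⟩
  rw [F_sub_eq hv, hlaw s hs]
  refine ENNReal.toReal_le_of_le_ofReal (by have := sub_nonneg.2 hv; positivity) ?_
  rw [withDensity_apply _ measurableSet_Ioc, Measure.restrict_restrict measurableSet_Ioc]
  calc ∫⁻ x in Ioc v v' ∩ Icc M.vlo M.vhi, ENNReal.ofReal (f x s)
      ≤ ∫⁻ x in Ioc v v' ∩ Icc M.vlo M.vhi, ENNReal.ofReal (max C 0) := by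
        refine setLIntegral_mono' (measurableSet_Ioc.inter measurableSet_Icc) fun x hx => ?_
        exact ENNReal.ofReal_le_ofReal
          ((le_abs_self _).trans ((hC (x, s) ⟨hx.2, hs⟩).trans (le_max_left _ _)))
    _ = ENNReal.ofReal (max C 0) * volume (Ioc v v' ∩ Icc M.vlo M.vhi) := setLIntegral_const _ _
    _ ≤ ENNReal.ofReal (max C 0) * volume (Ioc v v') := by gcongr; exact inter_subset_left
    _ = ENNReal.ofReal (max C 0 * (v' - v)) := by
        rw [Real.volume_Ioc, ENNReal.ofReal_mul (le_max_right _ _)]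

theorem AssumptionE.exists_le_F_sub (hE : M.AssumptionE Z) :
    ∃ δ : ℝ, 0 < δ ∧ ∀ s ∈ Icc (0 : ℝ) 1, ∀ v v', M.vlo ≤ v → v ≤ v' → v' ≤ M.vhi →
      δ * (v' - v) ≤ M.F v' s - M.F v s := by
  obtain ⟨f, -, ⟨δ, hδ, hf⟩, hlaw⟩ := hE.density
  refine ⟨δ, hδ, fun s hs v v' hlo hv hhi => ?_⟩
  rw [F_sub_eq hv]
  refine (ENNReal.ofReal_le_iff_le_toReal (measure_ne_top _ _)).1 ?_
  have hsub : Ioc v v' ⊆ Icc M.vlo M.vhi := fun x hx => ⟨hlo.trans hx.1.le, hx.2.trans hhi⟩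
  rw [hlaw s hs, withDensity_apply _ measurableSet_Ioc, Measure.restrict_restrict measurableSet_Ioc,
    inter_eq_self_of_subset_left hsub, ENNReal.ofReal_mul hδ.le, ← Real.volume_Ioc,
    ← setLIntegral_const]
  exact setLIntegral_mono' measurableSet_Ioc fun x hx =>
    ENNReal.ofReal_le_ofReal (hf x (hsub hx) s hs)

theorem AssumptionE.valueLaw_compl_Icc (hE : M.AssumptionE Z) {s : ℝ} (hs : s ∈ Icc (0 : ℝ) 1) :
    M.valueLaw s (Icc M.vlo M.vhi)ᶜ = 0 := by
  obtain ⟨f, -, -, hlaw⟩ := hE.density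
  rw [hlaw s hs, withDensity_apply _ measurableSet_Icc.compl,
    Measure.restrict_restrict measurableSet_Icc.compl]
  simp

theorem AssumptionE.valueLaw_singleton (hE : M.AssumptionE Z) {s : ℝ} (hs : s ∈ Icc (0 : ℝ) 1)
    (v : ℝ) : M.valueLaw s {v} = 0 := by
  obtain ⟨f, -, -, hlaw⟩ := hE.density
  rw [hlaw s hs, withDensity_apply _ (measurableSet_singleton v),
    Measure.restrict_restrict (measurableSet_singleton v)]
  exact setLIntegral_measure_zero _ _ (measure_mono_null inter_subset_left Real.volume_singleton)

theorem AssumptionE.F_eq_zero (hE : M.AssumptionE Z) {v s : ℝ} (hs : s ∈ Icc (0 : ℝ) 1)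
    (hv : v ≤ M.vlo) : M.F v s = 0 := by
  rw [F_eq_real, measureReal_def, ENNReal.toReal_eq_zero_iff]
  left
  refine measure_mono_null (t := (Icc M.vlo M.vhi)ᶜ ∪ {M.vlo}) (fun x hx => ?_)
    (measure_union_null (hE.valueLaw_compl_Icc hs) (hE.valueLaw_singleton hs _))
  rcases (le_trans hx hv : x ≤ M.vlo).eq_or_lt with h | h
  · exact Or.inr h
  · exact Or.inl fun h' => h'.1.not_gt h

theorem AssumptionE.F_eq_one (hE : M.AssumptionE Z) {v s : ℝ} (hs : s ∈ Icc (0 : ℝ) 1)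
    (hv : M.vhi ≤ v) : M.F v s = 1 := by
  have h : M.valueLaw s (Iic v)ᶜ = 0 :=
    measure_mono_null (compl_subset_compl.2 fun _ hx => hx.2.trans hv) (hE.valueLaw_compl_Icc hs)
  rw [F_eq_real, measureReal_def, (prob_compl_eq_zero_iff measurableSet_Iic).1 h,
    ENNReal.toReal_one]

theorem AssumptionE.F_lt_one (hE : M.AssumptionE Z) {v s : ℝ} (hs : s ∈ Icc (0 : ℝ) 1)
    (hv : v < M.vhi) : M.F v s < 1 := by
  obtain ⟨δ, hδ, h⟩ := hE.exists_le_F_sub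
  rcases le_total M.vlo v with hlo | hlo
  · have := h s hs v M.vhi hlo hv.le le_rfl
    rw [hE.F_eq_one hs le_rfl] at this
    have := mul_pos hδ (sub_pos.2 hv)
    linarith
  · rw [hE.F_eq_zero hs hlo]; exact one_pos

theorem AssumptionE.F_continuous_left (hE : M.AssumptionE Z) {s : ℝ} (hs : s ∈ Icc (0 : ℝ) 1) :
    Continuous fun v => M.F v s := by
  obtain ⟨C, hC, h⟩ := hE.exists_F_sub_le
  refine (LipschitzWith.of_le_add_mul ⟨C, hC⟩ fun x y => ?_).continuous
  rcases le_total y x with hxy | hxy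
  · have := h s hs y x hxy
    rw [Real.dist_eq, abs_of_nonneg (sub_nonneg.2 hxy)]
    change _ ≤ _ + C * _
    linarith
  · have := F_mono (M := M) s hxy
    have : 0 ≤ C * dist x y := by positivity
    change _ ≤ _ + C * _
    simp only at *
    linarith

end Cdf

/-! ### Entrants' c.d.f. and quantile function. -/

section EntrantCdf

variable {s : ℝ}

theorem one_sub_mul_Fc (hs : s < 1) (v : ℝ) : (1 - s) * M.Fc v s = ∫ t in s..1, M.F v t := by
  rw [Fc, ← mul_assoc, mul_one_div_cancel (sub_pos.2 hs).ne', one_mul]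

theorem Fc_mono (hs : s < 1) : Monotone fun v => M.Fc v s := by
  intro v v' h
  refine le_of_mul_le_mul_left ?_ (sub_pos.2 hs)
  simp only [one_sub_mul_Fc hs]
  exact intervalIntegral.integral_mono_on hs.le (intervalIntegrable_F _ _ _)
    (intervalIntegrable_F _ _ _) fun t _ => F_mono t h

theorem Fc_mem_Icc (hs : s < 1) (v : ℝ) : M.Fc v s ∈ Icc (0 : ℝ) 1 := by
  constructor
  · refine le_of_mul_le_mul_left ?_ (sub_pos.2 hs)
    rw [one_sub_mul_Fc hs, mul_zero]
    exact intervalIntegral.integral_nonneg hs.le fun t _ => F_nonneg v t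
  · refine le_of_mul_le_mul_left ?_ (sub_pos.2 hs)
    rw [one_sub_mul_Fc hs]
    calc ∫ t in s..1, M.F v t ≤ ∫ _ in s..1, (1 : ℝ) :=
          intervalIntegral.integral_mono_on hs.le (intervalIntegrable_F _ _ _)
            intervalIntegrable_const fun t _ => F_le_one v t
      _ = (1 - s) * 1 := by simp

theorem AssumptionE.Fc_eq_zero (hE : M.AssumptionE Z) (hs : s ∈ Ioo (0 : ℝ) 1) {v : ℝ}
    (hv : v ≤ M.vlo) : M.Fc v s = 0 := by
  have : ∫ t in s..1, M.F v t = ∫ _ in s..1, (0 : ℝ) :=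
    intervalIntegral.integral_congr fun t ht => by
      rw [uIcc_of_le hs.2.le] at ht
      exact hE.F_eq_zero ⟨hs.1.le.trans ht.1, ht.2⟩ hv
  rw [Fc, this]; simp

theorem AssumptionE.Fc_eq_one (hE : M.AssumptionE Z) (hs : s ∈ Ioo (0 : ℝ) 1) {v : ℝ}
    (hv : M.vhi ≤ v) : M.Fc v s = 1 := by
  have : ∫ t in s..1, M.F v t = ∫ _ in s..1, (1 : ℝ) :=
    intervalIntegral.integral_congr fun t ht => by
      rw [uIcc_of_le hs.2.le] at ht
      exact hE.F_eq_one ⟨hs.1.le.trans ht.1, ht.2⟩ hv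
  have h1 : 1 - s ≠ 0 := (sub_pos.2 hs.2).ne'
  rw [Fc, this]; simp [h1]

theorem AssumptionE.exists_Fc_sub_bounds (hE : M.AssumptionE Z) (hs : s ∈ Ioo (0 : ℝ) 1) :
    ∃ δ C : ℝ, 0 < δ ∧ 0 ≤ C ∧
      (∀ v v', v ≤ v' → M.Fc v' s - M.Fc v s ≤ C * (v' - v)) ∧
      ∀ v v', M.vlo ≤ v → v ≤ v' → v' ≤ M.vhi → δ * (v' - v) ≤ M.Fc v' s - M.Fc v s := by
  obtain ⟨C, hC, hup⟩ := hE.exists_F_sub_le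
  obtain ⟨δ, hδ, hlo⟩ := hE.exists_le_F_sub
  have hsub : ∀ v v', (1 - s) * (M.Fc v' s - M.Fc v s) = ∫ t in s..1, (M.F v' t - M.F v t) := by
    intro v v'
    rw [mul_sub, one_sub_mul_Fc hs.2, one_sub_mul_Fc hs.2, intervalIntegral.integral_sub
      (intervalIntegrable_F _ _ _) (intervalIntegrable_F _ _ _)]
  have hconst : ∀ x : ℝ, (1 - s) * x = ∫ _ in s..1, x := by simp
  have hii : ∀ v v', IntervalIntegrable (fun t => M.F v' t - M.F v t) volume s 1 := fun v v' =>
    (intervalIntegrable_F _ _ _).sub (intervalIntegrable_F _ _ _)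
  refine ⟨δ, C, hδ, hC, fun v v' h => ?_, fun v v' h1 h h2 => ?_⟩
  · refine le_of_mul_le_mul_left ?_ (sub_pos.2 hs.2)
    rw [hsub, hconst]
    exact intervalIntegral.integral_mono_on hs.2.le (hii v v') intervalIntegrable_const
      fun t ht => hup t ⟨hs.1.le.trans ht.1, ht.2⟩ v v' h
  · refine le_of_mul_le_mul_left ?_ (sub_pos.2 hs.2)
    rw [hsub, hconst]
    exact intervalIntegral.integral_mono_on hs.2.le intervalIntegrable_const (hii v v')
      fun t ht => hlo t ⟨hs.1.le.trans ht.1, ht.2⟩ v v' h1 h h2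

theorem AssumptionE.Fc_continuous (hE : M.AssumptionE Z) (hs : s ∈ Ioo (0 : ℝ) 1) :
    Continuous fun v => M.Fc v s := by
  obtain ⟨-, C, -, hC, h, -⟩ := hE.exists_Fc_sub_bounds hs
  refine (LipschitzWith.of_le_add_mul ⟨C, hC⟩ fun x y => ?_).continuous
  rcases le_total y x with hxy | hxy
  · have := h y x hxy
    rw [Real.dist_eq, abs_of_nonneg (sub_nonneg.2 hxy)]
    change _ ≤ _ + C * _
    linarith
  · have := Fc_mono (M := M) hs.2 hxy
    have : 0 ≤ C * dist x y := by positivity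
    change _ ≤ _ + C * _
    simp only at *
    linarith

theorem AssumptionE.Fc_strictMonoOn (hE : M.AssumptionE Z) (hs : s ∈ Ioo (0 : ℝ) 1) :
    StrictMonoOn (fun v => M.Fc v s) (Icc M.vlo M.vhi) := by
  obtain ⟨δ, -, hδ, -, -, h⟩ := hE.exists_Fc_sub_bounds hs
  intro v hv v' hv' hlt
  have := h v v' hv.1 hlt.le hv'.2
  have := mul_pos hδ (sub_pos.2 hlt)
  simp only
  linarith

/-- The constraint `M.vlo ≤ v` in `Vc` matters at level 0, where the infimum would otherwise run
over all of ℝ. -/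
theorem AssumptionE.Vc_Fc (hE : M.AssumptionE Z) (hs : s ∈ Ioo (0 : ℝ) 1) {v : ℝ}
    (hv : v ∈ Icc M.vlo M.vhi) : M.Vc (M.Fc v s) s = v := by
  refine IsLeast.csInf_eq ⟨⟨hv.1, le_rfl⟩, fun w hw => ?_⟩
  by_contra! hlt
  exact hw.2.not_gt (hE.Fc_strictMonoOn hs ⟨hw.1, hlt.le.trans hv.2⟩ hv hlt)

theorem AssumptionE.exists_Fc_eq (hE : M.AssumptionE Z) (hs : s ∈ Ioo (0 : ℝ) 1) {α : ℝ}
    (hα : α ∈ Icc (0 : ℝ) 1) : ∃ v ∈ Icc M.vlo M.vhi, M.Fc v s = α := by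
  have := intermediate_value_Icc hE.vlo_lt_vhi.le (hE.Fc_continuous hs).continuousOn
  rw [hE.Fc_eq_zero hs le_rfl, hE.Fc_eq_one hs le_rfl] at this
  exact this hα

theorem AssumptionE.Vc_mem (hE : M.AssumptionE Z) (hs : s ∈ Ioo (0 : ℝ) 1) {α : ℝ}
    (hα : α ∈ Icc (0 : ℝ) 1) : M.Vc α s ∈ Icc M.vlo M.vhi := by
  obtain ⟨v, hv, rfl⟩ := hE.exists_Fc_eq hs hα
  rwa [hE.Vc_Fc hs hv]

theorem AssumptionE.Fc_Vc (hE : M.AssumptionE Z) (hs : s ∈ Ioo (0 : ℝ) 1) {α : ℝ}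
    (hα : α ∈ Icc (0 : ℝ) 1) : M.Fc (M.Vc α s) s = α := by
  obtain ⟨v, hv, rfl⟩ := hE.exists_Fc_eq hs hα
  rw [hE.Vc_Fc hs hv]

theorem AssumptionE.Vc_zero (hE : M.AssumptionE Z) (hs : s ∈ Ioo (0 : ℝ) 1) :
    M.Vc 0 s = M.vlo := by
  rw [← hE.Fc_eq_zero hs le_rfl, hE.Vc_Fc hs (left_mem_Icc.2 hE.vlo_lt_vhi.le)]

theorem AssumptionE.Vc_one (hE : M.AssumptionE Z) (hs : s ∈ Ioo (0 : ℝ) 1) :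
    M.Vc 1 s = M.vhi := by
  rw [← hE.Fc_eq_one hs le_rfl, hE.Vc_Fc hs (right_mem_Icc.2 hE.vlo_lt_vhi.le)]

theorem AssumptionE.Vc_continuousOn (hE : M.AssumptionE Z) (hs : s ∈ Ioo (0 : ℝ) 1) :
    ContinuousOn (fun α => M.Vc α s) (Icc 0 1) := by
  obtain ⟨δ, -, hδ, -, -, h⟩ := hE.exists_Fc_sub_bounds hs
  refine (LipschitzOnWith.of_le_add_mul ⟨δ⁻¹, (inv_pos.2 hδ).le⟩ fun x hx y hy => ?_).continuousOn
  obtain ⟨v, hv, rfl⟩ := hE.exists_Fc_eq hs hx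
  obtain ⟨w, hw, rfl⟩ := hE.exists_Fc_eq hs hy
  rw [hE.Vc_Fc hs hv, hE.Vc_Fc hs hw]
  change _ ≤ _ + δ⁻¹ * _
  rcases le_total v w with hvw | hvw
  · have : 0 ≤ δ⁻¹ * dist (M.Fc v s) (M.Fc w s) := by positivity
    linarith
  · have h1 := h w v hw.1 hvw hv.2
    have h2 : v - w ≤ δ⁻¹ * (M.Fc v s - M.Fc w s) := by
      rw [inv_mul_eq_div, le_div_iff₀ hδ]; linarith
    have h3 : δ⁻¹ * (M.Fc v s - M.Fc w s) ≤ δ⁻¹ * dist (M.Fc v s) (M.Fc w s) := by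
      gcongr; exact le_abs_self _
    linarith

end EntrantCdf

end EntryModel

namespace EntryModel

variable {d : ℕ} {M : EntryModel d} {Z : Set (EuclideanSpace ℝ (Fin d))}

/-! ### Outcome probabilities in terms of one buyer's law. -/

section Outcomes

instance : IsFiniteMeasure M.buyerLaw := by unfold buyerLaw; infer_instance

instance (m : ℕ) : IsFiniteMeasure (M.buyersLaw m) := by unfold buyersLaw; infer_instance

/-- Boxes in a finite product need no measurable sides, so nothing is asked of the bid function
here. -/
theorem buyersLaw_real_forall (m : ℕ) (E : Set (ℝ × ℝ)) :
    (M.buyersLaw m).real {ω | ∀ i, ω i ∈ E} = M.buyerLaw.real E ^ m := by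
  have h : {ω : Fin m → ℝ × ℝ | ∀ i, ω i ∈ E} = Set.pi univ fun _ => E := by ext; simp
  rw [h, measureReal_def, buyersLaw, Measure.pi_pi]
  simp [measureReal_def]

theorem buyerLaw_real_enter_imp {s : ℝ} (hs : s ∈ Ioo (0 : ℝ) 1) {T : Set ℝ}
    (hT : MeasurableSet T) :
    M.buyerLaw.real {x | s ≤ x.1 → x.2 ∈ T} = s + ∫ t in s..1, (M.valueLaw t).real T := by
  have hset : {x : ℝ × ℝ | s ≤ x.1 → x.2 ∈ T} = Iio s ×ˢ univ ∪ Ici s ×ˢ T := by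
    ext x
    rcases lt_or_ge x.1 s with h | h
    · simp [h, h.not_ge]
    · simp [h, h.not_gt]
  have hdisj : Disjoint (Iio s ×ˢ (univ : Set ℝ)) (Ici s ×ˢ T) :=
    Set.disjoint_left.2 fun x hx hx' => (mem_Ici.1 hx'.1).not_gt (mem_Iio.1 hx.1)
  have h1 : Iio s ∩ Icc 0 1 = Ico 0 s := by
    ext x; simp only [mem_inter_iff, mem_Iio, mem_Icc, mem_Ico]
    exact ⟨fun h => ⟨h.2.1, h.1⟩, fun h => ⟨h.2, h.1, h.2.le.trans hs.2.le⟩⟩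
  have h2 : Ici s ∩ Icc 0 1 = Icc s 1 := by
    ext x; simp only [mem_inter_iff, mem_Ici, mem_Icc]
    exact ⟨fun h => ⟨h.1, h.2.2⟩, fun h => ⟨h.1, hs.1.le.trans h.1, h.2⟩⟩
  rw [hset, measureReal_union hdisj (measurableSet_Ici.prod hT)]
  congr 1
  · rw [measureReal_def, buyerLaw, Measure.compProd_apply_prod measurableSet_Iio MeasurableSet.univ,
      Measure.restrict_restrict measurableSet_Iio, h1]
    simp [hs.1.le]
  · rw [measureReal_def, buyerLaw, Measure.compProd_apply_prod measurableSet_Ici hT,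
      Measure.restrict_restrict measurableSet_Ici, h2, intervalIntegral.integral_of_le hs.2.le,
      ← integral_Icc_eq_integral_Ioc]
    exact (integral_toReal (Kernel.measurable_coe _ hT).aemeasurable
      (Filter.Eventually.of_forall fun t => measure_lt_top _ _)).symm

/-- Probability that a buyer does not enter with a bid above `b`. -/
noncomputable def probBidAtMost (M : EntryModel d) (z : EuclideanSpace ℝ (Fin d)) (b : ℝ) : ℝ :=
  M.buyerLaw.real {x | M.threshold z ≤ x.1 → M.bidOfValue z x.2 ≤ b}

theorem probBidAtMost_mono (z : EuclideanSpace ℝ (Fin d)) : Monotone (M.probBidAtMost z) :=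
  fun _ _ h => measureReal_mono fun _ hx hs => (hx hs).trans h

theorem probBidAtMost_nonneg (z : EuclideanSpace ℝ (Fin d)) (b : ℝ) : 0 ≤ M.probBidAtMost z b :=
  measureReal_nonneg

theorem winProb_eq (z : EuclideanSpace ℝ (Fin d)) (a : ℝ) :
    M.winProb z a = M.probBidAtMost z (M.bid z a) ^ (M.nbar - 1) :=
  buyersLaw_real_forall _ {x | M.threshold z ≤ x.1 → M.bidOfValue z x.2 ≤ M.bid z a}

theorem outcome_le_iff (z : EuclideanSpace ℝ (Fin d)) (ω : Fin M.nbar → ℝ × ℝ) (b : ℝ) :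
    M.outcome z ω ≤ (b : WithBot ℝ) ↔
      ∀ i, M.threshold z ≤ (ω i).1 → M.bidOfValue z (ω i).2 ≤ b := by
  simp [outcome]

theorem outcome_eq_bot_iff (z : EuclideanSpace ℝ (Fin d)) (ω : Fin M.nbar → ℝ × ℝ) :
    M.outcome z ω = ⊥ ↔ ∀ i, (ω i).1 < M.threshold z := by
  simp [outcome, Finset.sup_eq_bot_iff]

theorem probNotSold_eq {z : EuclideanSpace ℝ (Fin d)} (hs : M.threshold z ∈ Ioo (0 : ℝ) 1) :
    M.probNotSold z = M.threshold z ^ M.nbar := by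
  have h := buyerLaw_real_enter_imp (M := M) hs MeasurableSet.empty
  simp only [mem_empty_iff_false, imp_false, not_le, measureReal_empty,
    intervalIntegral.integral_zero, add_zero] at h
  simp only [probNotSold, outcome_eq_bot_iff]
  exact (buyersLaw_real_forall _ {x : ℝ × ℝ | x.1 < M.threshold z}).trans (by rw [h])

/-- The unsold outcome `⊥` lies below every bid, so adding it turns the event into a product event
over buyers. -/
theorem probNotSold_add_probSoldAtMost (z : EuclideanSpace ℝ (Fin d)) (b : ℝ) :
    M.probNotSold z + M.probSoldAtMost z b = M.probBidAtMost z b ^ M.nbar := by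
  have hm : MeasurableSet {ω : Fin M.nbar → ℝ × ℝ | M.outcome z ω = ⊥} := by
    simp only [outcome_eq_bot_iff, ofPred_forall]
    exact MeasurableSet.iInter fun i =>
      measurableSet_lt (measurable_fst.comp (measurable_pi_apply i)) measurable_const
  have hsub : {ω : Fin M.nbar → ℝ × ℝ | M.outcome z ω = ⊥} ⊆ {ω | M.outcome z ω ≤ (b : WithBot ℝ)} :=
    fun ω hω => (show M.outcome z ω = ⊥ from hω).le.trans bot_le
  have hdiff : {ω : Fin M.nbar → ℝ × ℝ | M.outcome z ω ≠ ⊥ ∧ M.outcome z ω ≤ (b : WithBot ℝ)} =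
      {ω | M.outcome z ω ≤ (b : WithBot ℝ)} \ {ω | M.outcome z ω = ⊥} := by
    ext ω; exact and_comm
  rw [probNotSold, probSoldAtMost, hdiff, measureReal_sdiff hsub hm, add_sub_cancel]
  simp only [outcome_le_iff]
  exact buyersLaw_real_forall _ {x | M.threshold z ≤ x.1 → M.bidOfValue z x.2 ≤ b}

theorem probBidAtMost_bid (hE : M.AssumptionE Z) (hM : M.IsEquilibrium Z)
    {z : EuclideanSpace ℝ (Fin d)} (hz : z ∈ Z) {a : ℝ} (ha : a ∈ Icc (0 : ℝ) 1) :
    M.probBidAtMost z (M.bid z a) = M.threshold z + (1 - M.threshold z) * a := by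
  have hs := hM.threshold_mem z hz
  have hset : {v | M.bidOfValue z v ≤ M.bid z a} = {v | M.Fc v (M.threshold z) ≤ a} := by
    ext v
    exact (hM.bid_strictMono z hz).le_iff_le (Fc_mem_Icc hs.2 v) ha
  have hm : MeasurableSet {v | M.bidOfValue z v ≤ M.bid z a} := by
    rw [hset]
    exact measurableSet_le (hE.Fc_continuous hs).measurable measurable_const
  refine (buyerLaw_real_enter_imp hs hm).trans ?_
  congr 1
  have hV := hE.Vc_mem hs ha
  conv_rhs => rw [← hE.Fc_Vc hs ha, one_sub_mul_Fc hs.2]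
  refine intervalIntegral.integral_congr fun t ht => ?_
  rw [uIcc_of_le hs.2.le] at ht
  have ht' : t ∈ Icc (0 : ℝ) 1 := ⟨hs.1.le.trans ht.1, ht.2⟩
  rw [F_eq_real, hset]
  refine measureReal_congr ?_
  -- `Fc` is strictly increasing only on the support, so the two events agree only almost
  -- everywhere.
  have hae : ∀ᵐ v ∂(M.valueLaw t), v ∈ Icc M.vlo M.vhi := hE.valueLaw_compl_Icc ht'
  filter_upwards [hae] with v hv
  refine propext ?_
  change M.Fc v _ ≤ a ↔ v ≤ _
  conv_lhs => rw [← hE.Fc_Vc hs ha]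
  exact (hE.Fc_strictMonoOn hs).le_iff_le hv hV

end Outcomes

end EntryModel

open Filter Topology Asymptotics in
/-- A function whose increments relative to `P` are squeezed between the values of a continuous
`V` has derivative `V` with respect to `P`. -/
theorem hasDerivWithinAt_of_increments_between {Y V P : ℝ → ℝ} {S : Set ℝ} {x P' : ℝ}
    (hx : x ∈ S) (hV : ContinuousWithinAt V S x) (hP : HasDerivWithinAt P P' S x)
    (h : ∀ y ∈ S, ∀ w ∈ S, V y * (P w - P y) ≤ Y w - Y y) :
    HasDerivWithinAt Y (V x * P') S x := by
  rw [hasDerivWithinAt_iff_isLittleO]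
  have h1 : (fun y => V x * (P y - P x - (y - x) • P')) =o[𝓝[S] x] fun y => y - x :=
    (hasDerivWithinAt_iff_isLittleO.1 hP).const_mul_left _
  have h2 : (fun y => (V y - V x) * (P y - P x)) =o[𝓝[S] x] fun y => y - x := by
    have hV' : (fun y => V y - V x) =o[𝓝[S] x] fun _ => (1 : ℝ) := by
      rw [isLittleO_one_iff]
      simpa using hV.tendsto.sub_const (V x)
    simpa using hV'.mul_isBigO hP.hasFDerivWithinAt.isBigO_sub
  have h3 : (fun y => Y y - Y x - V x * (P y - P x)) =o[𝓝[S] x] fun y => y - x := by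
    -- The hypothesis used in both orders gives 0 ≤ Y y - Y x - V x (P y - P x) ≤ (V y - V x)(P y -
    -- P x).
    refine IsBigO.trans_isLittleO (IsBigO.of_bound 1 ?_) h2
    filter_upwards [self_mem_nhdsWithin] with y hy
    have ha := h x hx y hy
    have hb := h y hy x hx
    rw [one_mul, Real.norm_eq_abs, Real.norm_eq_abs, abs_of_nonneg (by linarith)]
    refine le_trans ?_ (le_abs_self _)
    linarith
  refine (h3.add h1).congr_left fun y => ?_
  simp only [smul_eq_mul]
  ring

/-- First-order condition of the first-price auction in terms of the quantile function `Q` of the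
winning bid, with winning probability `t ^ κ` at level `t`. -/
theorem hasDerivWithinAt_of_bestResponse {Q V : ℝ → ℝ} {p κ t : ℝ} (hp : 0 < p)
    (ht : t ∈ Icc p 1) (hV : ContinuousOn V (Icc p 1))
    (h : ∀ x ∈ Icc p 1, ∀ y ∈ Icc p 1, (V x - Q y) * y ^ κ ≤ (V x - Q x) * x ^ κ) :
    HasDerivWithinAt Q ((V t - Q t) * κ / t) (Icc p 1) t := by
  have ht0 : 0 < t := hp.trans_le ht.1
  have hP : HasDerivWithinAt (fun x : ℝ => x ^ κ) (κ * t ^ (κ - 1)) (Icc p 1) t :=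
    (Real.hasDerivAt_rpow_const (Or.inl ht0.ne')).hasDerivWithinAt
  -- Optimality bounds the increments of the expected payment Q x · x^κ, so differentiability of Q
  -- is derived, not assumed.
  have hY : HasDerivWithinAt (fun x => Q x * x ^ κ) (V t * (κ * t ^ (κ - 1))) (Icc p 1) t :=
    hasDerivWithinAt_of_increments_between ht (hV t ht) hP fun x hx y hy => by
      have := h x hx y hy
      linarith
  have htκ : t ^ κ ≠ 0 := (Real.rpow_pos_of_pos ht0 κ).ne'
  have hQ := (hY.div hP htκ).congr (f₁ := Q)
    (fun x hx => by
      have : x ^ κ ≠ 0 := (Real.rpow_pos_of_pos (hp.trans_le hx.1) κ).ne'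
      simp [this]) (by simp [htκ])
  refine hQ.congr_deriv ?_
  rw [Real.rpow_sub_one ht0.ne']
  field_simp

/-- Two continuous sections of the same monotone function coincide. -/
theorem eqOn_of_monotone_leftInverse {H Q Q' : ℝ → ℝ} {p q : ℝ} (hpq : p < q) (hH : Monotone H)
    (hQ : ContinuousOn Q (Icc p q)) (hQ' : ContinuousOn Q' (Icc p q))
    (h : ∀ x ∈ Icc p q, H (Q x) = x) (h' : ∀ x ∈ Icc p q, H (Q' x) = x) :
    EqOn Q Q' (Icc p q) := by
  have key : ∀ {R R' : ℝ → ℝ}, ContinuousOn R (Icc p q) → ContinuousOn R' (Icc p q) →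
      (∀ x ∈ Icc p q, H (R x) = x) → (∀ x ∈ Icc p q, H (R' x) = x) →
      ∀ x ∈ Ico p q, R x ≤ R' x := by
    intro R R' _ hR' hl hl' x hx
    have hsub : Ioc x q ⊆ Icc p q := fun y hy => ⟨hx.1.trans hy.1.le, hy.2⟩
    have hx' : x ∈ Icc p q := Ico_subset_Icc_self hx
    have hcl : x ∈ closure (Ioc x q) := by
      rw [closure_Ioc hx.2.ne]; exact left_mem_Icc.2 hx.2.le
    have : (nhdsWithin x (Ioc x q)).NeBot := mem_closure_iff_nhdsWithin_neBot.1 hcl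
    -- For y > x, H (R' y) = y > x = H (R x) forces R x ≤ R' y; let y decrease to x.
    refine ge_of_tendsto ((hR' x hx').mono hsub) ?_
    filter_upwards [self_mem_nhdsWithin] with y hy
    by_contra! hlt
    have := hH hlt.le
    rw [hl' y (hsub hy), hl x hx'] at this
    exact this.not_gt hy.1
  have hIco : EqOn Q Q' (Ico p q) := fun x hx =>
    le_antisymm (key hQ hQ' h h' x hx) (key hQ' hQ h' h x hx)
  exact hIco.of_subset_closure hQ hQ' Ico_subset_Icc_self (closure_Ico hpq.ne).ge

namespace EntryModel

variable {d : ℕ} {M : EntryModel d} {Z : Set (EuclideanSpace ℝ (Fin d))}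

/-! ### Quantile function of the winning bid and its first-order condition. -/

section WinningBid

/-- Level of an entrant who has probability `t` of being weakly ahead of `nbar` buyers. -/
noncomputable def level (M : EntryModel d) (z : EuclideanSpace ℝ (Fin d)) (t : ℝ) : ℝ :=
  (t ^ (1 / (M.nbar : ℝ)) - M.threshold z) / (1 - M.threshold z)

variable {z : EuclideanSpace ℝ (Fin d)}

theorem threshold_add_mul_level (hs : M.threshold z < 1) (t : ℝ) :
    M.threshold z + (1 - M.threshold z) * M.level z t = t ^ (1 / (M.nbar : ℝ)) := by
  rw [level, mul_div_cancel₀ _ (sub_pos.2 hs).ne', add_sub_cancel]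

theorem level_pow (hn : M.nbar ≠ 0) (hs : M.threshold z ∈ Ioo (0 : ℝ) 1) {a : ℝ} (ha : 0 ≤ a) :
    M.level z ((M.threshold z + (1 - M.threshold z) * a) ^ M.nbar) = a := by
  have h1 : 0 < 1 - M.threshold z := sub_pos.2 hs.2
  have h0 : 0 ≤ M.threshold z + (1 - M.threshold z) * a := add_nonneg hs.1.le (by positivity)
  rw [level, one_div, Real.pow_rpow_inv_natCast h0 hn, add_sub_cancel_left,
    mul_div_cancel_left₀ _ h1.ne']

theorem level_one (hs : M.threshold z < 1) : M.level z 1 = 1 := by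
  rw [level, Real.one_rpow, div_self (sub_pos.2 hs).ne']

theorem level_mem_Icc (hn : M.nbar ≠ 0) (hs : M.threshold z ∈ Ioo (0 : ℝ) 1) {t : ℝ}
    (ht : t ∈ Icc (M.threshold z ^ M.nbar) 1) : M.level z t ∈ Icc (0 : ℝ) 1 := by
  have h1 : 0 < 1 - M.threshold z := sub_pos.2 hs.2
  have hp : 0 < M.threshold z ^ M.nbar := pow_pos hs.1 _
  constructor
  · refine div_nonneg (sub_nonneg.2 ?_) h1.le
    calc M.threshold z = (M.threshold z ^ M.nbar) ^ (1 / (M.nbar : ℝ)) := by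
          rw [one_div, Real.pow_rpow_inv_natCast hs.1.le hn]
      _ ≤ t ^ (1 / (M.nbar : ℝ)) := Real.rpow_le_rpow hp.le ht.1 (by positivity)
  · rw [level, div_le_one h1]
    have := Real.rpow_le_one (hp.le.trans ht.1) ht.2 (by positivity : 0 ≤ 1 / (M.nbar : ℝ))
    linarith

theorem level_continuous (hn : M.nbar ≠ 0) : Continuous (M.level z) := by
  have : Continuous fun t : ℝ => t ^ (1 / (M.nbar : ℝ)) :=
    Real.continuous_rpow_const (by positivity)
  unfold level
  fun_prop

theorem AssumptionE.nbar_ne_zero (hE : M.AssumptionE Z) : M.nbar ≠ 0 := by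
  have := hE.two_le_nbar
  omega

theorem probBidAtMost_bid_level (hE : M.AssumptionE Z) (hM : M.IsEquilibrium Z) (hz : z ∈ Z)
    {t : ℝ} (ht : t ∈ Icc (M.threshold z ^ M.nbar) 1) :
    M.probBidAtMost z (M.bid z (M.level z t)) = t ^ (1 / (M.nbar : ℝ)) := by
  have hs := hM.threshold_mem z hz
  rw [probBidAtMost_bid hE hM hz (level_mem_Icc hE.nbar_ne_zero hs ht),
    threshold_add_mul_level hs.2]

theorem probBidAtMost_bid_level_pow (hE : M.AssumptionE Z) (hM : M.IsEquilibrium Z) (hz : z ∈ Z)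
    {t : ℝ} (ht : t ∈ Icc (M.threshold z ^ M.nbar) 1) :
    M.probBidAtMost z (M.bid z (M.level z t)) ^ M.nbar = t := by
  have hp : 0 < M.threshold z ^ M.nbar := pow_pos (hM.threshold_mem z hz).1 _
  rw [probBidAtMost_bid_level hE hM hz ht, one_div,
    Real.rpow_inv_natCast_pow (hp.le.trans ht.1) hE.nbar_ne_zero]

theorem winProb_level (hE : M.AssumptionE Z) (hM : M.IsEquilibrium Z) (hz : z ∈ Z)
    {t : ℝ} (ht : t ∈ Icc (M.threshold z ^ M.nbar) 1) :
    M.winProb z (M.level z t) = t ^ (1 - 1 / (M.nbar : ℝ)) := by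
  have hp : 0 < M.threshold z ^ M.nbar := pow_pos (hM.threshold_mem z hz).1 _
  have hn : (M.nbar : ℝ) ≠ 0 := Nat.cast_ne_zero.2 hE.nbar_ne_zero
  rw [winProb_eq, probBidAtMost_bid_level hE hM hz ht, ← Real.rpow_natCast,
    ← Real.rpow_mul (hp.le.trans ht.1), Nat.cast_sub (by have := hE.two_le_nbar; omega)]
  congr 1
  field_simp
  simp

theorem Vc_level_continuousOn (hE : M.AssumptionE Z) (hM : M.IsEquilibrium Z) (hz : z ∈ Z) :
    ContinuousOn (fun t => M.Vc (M.level z t) (M.threshold z))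
      (Icc (M.threshold z ^ M.nbar) 1) :=
  (hE.Vc_continuousOn (hM.threshold_mem z hz)).comp
    (level_continuous hE.nbar_ne_zero).continuousOn
    fun _ ht => level_mem_Icc hE.nbar_ne_zero (hM.threshold_mem z hz) ht

theorem hasDerivWithinAt_bid_level (hE : M.AssumptionE Z) (hM : M.IsEquilibrium Z) (hz : z ∈ Z)
    {t : ℝ} (ht : t ∈ Icc (M.threshold z ^ M.nbar) 1) :
    HasDerivWithinAt (fun t => M.bid z (M.level z t))
      ((M.Vc (M.level z t) (M.threshold z) - M.bid z (M.level z t)) * (1 - 1 / (M.nbar : ℝ)) / t)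
      (Icc (M.threshold z ^ M.nbar) 1) t := by
  have hs := hM.threshold_mem z hz
  refine hasDerivWithinAt_of_bestResponse (Q := fun t => M.bid z (M.level z t))
    (V := fun t => M.Vc (M.level z t) (M.threshold z)) (pow_pos hs.1 _) ht
    (Vc_level_continuousOn hE hM hz) fun x hx y hy => ?_
  have := hM.best_response z hz (M.level z x) (level_mem_Icc hE.nbar_ne_zero hs hx)
    (M.level z y) (level_mem_Icc hE.nbar_ne_zero hs hy)
  rwa [winProb_level hE hM hz hx, winProb_level hE hM hz hy] at this

end WinningBid

/-! ### Identification from the first-order condition. -/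

section Identification

variable {M' : EntryModel d} {z : EuclideanSpace ℝ (Fin d)}

theorem SameOutcomes.threshold_pow_eq (hM : M.IsEquilibrium Z) (hM' : M'.IsEquilibrium Z)
    (hobs : SameOutcomes M M' Z) (hz : z ∈ Z) :
    M.threshold z ^ M.nbar = M'.threshold z ^ M'.nbar := by
  rw [← probNotSold_eq (hM.threshold_mem z hz), ← probNotSold_eq (hM'.threshold_mem z hz),
    (hobs z hz).1]

/-- The quantile function of the winning bid is identified. -/
theorem SameOutcomes.bid_level_eqOn (hE : M.AssumptionE Z) (hE' : M'.AssumptionE Z)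
    (hM : M.IsEquilibrium Z) (hM' : M'.IsEquilibrium Z)
    (hobs : SameOutcomes M M' Z) (hz : z ∈ Z) :
    EqOn (fun t => M.bid z (M.level z t)) (fun t => M'.bid z (M'.level z t))
      (Icc (M.threshold z ^ M.nbar) 1) := by
  have hp := hobs.threshold_pow_eq hM hM' hz
  have hs := hM.threshold_mem z hz
  refine eqOn_of_monotone_leftInverse (H := fun b => M.probBidAtMost z b ^ M.nbar)
    (pow_lt_one₀ hs.1.le hs.2 hE.nbar_ne_zero)
    (fun b b' h => pow_le_pow_left₀ (probBidAtMost_nonneg z b) (probBidAtMost_mono z h) _)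
    (fun t ht => (hasDerivWithinAt_bid_level hE hM hz ht).continuousWithinAt) ?_
    (fun t ht => probBidAtMost_bid_level_pow hE hM hz ht) ?_
  · rw [hp]
    exact fun t ht => (hasDerivWithinAt_bid_level hE' hM' hz ht).continuousWithinAt
  · intro t ht
    rw [← probNotSold_add_probSoldAtMost, (hobs z hz).1, (hobs z hz).2,
      probNotSold_add_probSoldAtMost]
    rw [hp] at ht
    exact probBidAtMost_bid_level_pow hE' hM' hz ht

/-- One function Q satisfies both first-order conditions, and its derivative within the interval is
unique, endpoints included. -/
theorem SameOutcomes.markup_eq (hE : M.AssumptionE Z) (hE' : M'.AssumptionE Z)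
    (hM : M.IsEquilibrium Z) (hM' : M'.IsEquilibrium Z)
    (hobs : SameOutcomes M M' Z) (hz : z ∈ Z) {t : ℝ}
    (ht : t ∈ Icc (M.threshold z ^ M.nbar) 1) :
    (M.Vc (M.level z t) (M.threshold z) - M.bid z (M.level z t)) * (1 - 1 / (M.nbar : ℝ)) =
      (M'.Vc (M'.level z t) (M'.threshold z) - M.bid z (M.level z t)) *
        (1 - 1 / (M'.nbar : ℝ)) := by
  have hp := hobs.threshold_pow_eq hM hM' hz
  have hs := hM.threshold_mem z hz
  have hQ := hobs.bid_level_eqOn hE hE' hM hM' hz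
  have hd := hasDerivWithinAt_bid_level hE hM hz ht
  have hd' := hasDerivWithinAt_bid_level hE' hM' hz (hp ▸ ht)
  rw [← hp] at hd'
  have huniq : UniqueDiffWithinAt ℝ (Icc (M.threshold z ^ M.nbar) 1) t :=
    uniqueDiffOn_Icc (pow_lt_one₀ hs.1.le hs.2 hE.nbar_ne_zero) t ht
  have heq := huniq.eq_deriv _ hd (hd'.congr hQ (hQ ht))
  have ht0 : t ≠ 0 := ((pow_pos hs.1 _).trans_le ht.1).ne'
  rw [div_left_inj' ht0] at heq
  rw [heq]
  have := hQ ht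
  simp only at this
  rw [this]

theorem SameOutcomes.nbar_eq (hE : M.AssumptionE Z) (hE' : M'.AssumptionE Z)
    (hM : M.IsEquilibrium Z) (hM' : M'.IsEquilibrium Z) (hobs : SameOutcomes M M' Z)
    (hvar : ∃ z₁ ∈ Z, ∃ z₂ ∈ Z, M.bid z₁ 1 ≠ M.bid z₂ 1) : M.nbar = M'.nbar := by
  obtain ⟨z₁, h₁, z₂, h₂, hne⟩ := hvar
  have key : ∀ z ∈ Z, (M.vhi - M.bid z 1) * (1 - 1 / (M.nbar : ℝ)) =
      (M'.vhi - M.bid z 1) * (1 - 1 / (M'.nbar : ℝ)) := by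
    intro z hz
    have hs := hM.threshold_mem z hz
    have hs' := hM'.threshold_mem z hz
    have := hobs.markup_eq hE hE' hM hM' hz (t := 1)
      (right_mem_Icc.2 (pow_le_one₀ hs.1.le hs.2.le))
    rwa [level_one hs.2, level_one hs'.2, hE.Vc_one hs, hE'.Vc_one hs'] at this
  -- The terms in `vhi` do not depend on z and cancel in the difference.
  have h : (M.bid z₁ 1 - M.bid z₂ 1) * (1 / (M.nbar : ℝ)) =
      (M.bid z₁ 1 - M.bid z₂ 1) * (1 / (M'.nbar : ℝ)) := by
    linear_combination key z₁ h₁ - key z₂ h₂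
  have h' := mul_left_cancel₀ (sub_ne_zero.2 hne) h
  rw [one_div, one_div, inv_inj] at h'
  exact_mod_cast h'

theorem SameOutcomes.threshold_eq (hE : M.AssumptionE Z)
    (hM : M.IsEquilibrium Z) (hM' : M'.IsEquilibrium Z) (hobs : SameOutcomes M M' Z)
    (hn : M.nbar = M'.nbar) (hz : z ∈ Z) : M.threshold z = M'.threshold z := by
  have h := hobs.threshold_pow_eq hM hM' hz
  rw [← hn] at h
  exact (pow_left_inj₀ (hM.threshold_mem z hz).1.le (hM'.threshold_mem z hz).1.le
    hE.nbar_ne_zero).1 h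

theorem SameOutcomes.Vc_eq (hE : M.AssumptionE Z) (hE' : M'.AssumptionE Z)
    (hM : M.IsEquilibrium Z) (hM' : M'.IsEquilibrium Z) (hobs : SameOutcomes M M' Z)
    (hn : M.nbar = M'.nbar) (hz : z ∈ Z) {α : ℝ} (hα : α ∈ Icc (0 : ℝ) 1) :
    M.Vc α (M.threshold z) = M'.Vc α (M.threshold z) := by
  have hs := hM.threshold_mem z hz
  have h1 : 0 < 1 - M.threshold z := sub_pos.2 hs.2
  have hst := hobs.threshold_eq hE hM hM' hn hz
  have hl := level_pow hE.nbar_ne_zero hs hα.1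
  have hl' : M'.level z ((M.threshold z + (1 - M.threshold z) * α) ^ M.nbar) = α := by
    rw [hst, hn]
    exact level_pow hE'.nbar_ne_zero (hM'.threshold_mem z hz) hα.1
  have h := hobs.markup_eq hE hE' hM hM' hz
    (t := (M.threshold z + (1 - M.threshold z) * α) ^ M.nbar)
    ⟨pow_le_pow_left₀ hs.1.le (le_add_of_nonneg_right (mul_nonneg h1.le hα.1)) _,
      pow_le_one₀ (add_nonneg hs.1.le (mul_nonneg h1.le hα.1))
        (by nlinarith [mul_le_mul_of_nonneg_left hα.2 h1.le])⟩
  have hκ : 1 - 1 / (M.nbar : ℝ) ≠ 0 := by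
    have : (1 : ℝ) < M.nbar := by exact_mod_cast hE.two_le_nbar
    exact (sub_pos.2 ((div_lt_one (by linarith)).2 this)).ne'
  rw [hl, hl', ← hn, ← hst] at h
  linarith [mul_right_cancel₀ hκ h]

theorem SameOutcomes.vlo_eq (hE : M.AssumptionE Z) (hE' : M'.AssumptionE Z)
    (hM : M.IsEquilibrium Z) (hM' : M'.IsEquilibrium Z) (hobs : SameOutcomes M M' Z)
    (hn : M.nbar = M'.nbar) (hz : z ∈ Z) : M.vlo = M'.vlo := by
  have hs := hM.threshold_mem z hz
  rw [← hE.Vc_zero hs, ← hE'.Vc_zero hs]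
  exact hobs.Vc_eq hE hE' hM hM' hn hz (by simp)

theorem SameOutcomes.vhi_eq (hE : M.AssumptionE Z) (hE' : M'.AssumptionE Z)
    (hM : M.IsEquilibrium Z) (hM' : M'.IsEquilibrium Z) (hobs : SameOutcomes M M' Z)
    (hn : M.nbar = M'.nbar) (hz : z ∈ Z) : M.vhi = M'.vhi := by
  have hs := hM.threshold_mem z hz
  rw [← hE.Vc_one hs, ← hE'.Vc_one hs]
  exact hobs.Vc_eq hE hE' hM hM' hn hz (by simp)

theorem SameOutcomes.Fc_eq (hE : M.AssumptionE Z) (hE' : M'.AssumptionE Z)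
    (hM : M.IsEquilibrium Z) (hM' : M'.IsEquilibrium Z) (hobs : SameOutcomes M M' Z)
    (hn : M.nbar = M'.nbar) (hz : z ∈ Z) (v : ℝ) :
    M.Fc v (M.threshold z) = M'.Fc v (M.threshold z) := by
  have hs := hM.threshold_mem z hz
  have hlo := hobs.vlo_eq hE hE' hM hM' hn hz
  have hhi := hobs.vhi_eq hE hE' hM hM' hn hz
  rcases le_total v M.vlo with h | h
  · rw [hE.Fc_eq_zero hs h, hE'.Fc_eq_zero hs (hlo ▸ h)]
  rcases le_total M.vhi v with h' | h'
  · rw [hE.Fc_eq_one hs h', hE'.Fc_eq_one hs (hhi ▸ h')]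
  have hα := Fc_mem_Icc (M := M) hs.2 v
  have hV := hobs.Vc_eq hE hE' hM hM' hn hz hα
  rw [hE.Vc_Fc hs ⟨h, h'⟩] at hV
  conv_rhs => rw [hV]
  exact (hE'.Fc_Vc hs hα).symm

/-- The equilibrium gross profit of the marginal entrant increases with the threshold. -/
theorem AssumptionE.expectedProfit_strictMonoOn (hE : M.AssumptionE Z) (hhi : 0 < M.vhi) :
    StrictMonoOn (fun s => M.expectedProfit s s) (Ioo 0 1) := by
  have hcont : ∀ s ∈ Ioo (0 : ℝ) 1, Continuous fun v =>
      (1 - M.F v s) * (s + (1 - s) * M.Fc v s) ^ (M.nbar - 1) := by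
    intro s hs
    have h1 := hE.F_continuous_left (Ioo_subset_Icc_self hs)
    have h2 := hE.Fc_continuous hs
    fun_prop
  intro s hs s' hs' hlt
  rw [← sub_pos]
  simp only [expectedProfit]
  rw [← intervalIntegral.integral_sub ((hcont s' hs').intervalIntegrable _ _)
    ((hcont s hs).intervalIntegrable _ _)]
  refine intervalIntegral.intervalIntegral_pos_of_pos_on
    (((hcont s' hs').sub (hcont s hs)).intervalIntegrable _ _) (fun v hv => sub_pos.2 ?_) hhi
  have hF : M.F v s' ≤ M.F v s := by
    rcases le_total M.vlo v with h | h
    · exact hE.F_antitone v ⟨h, hv.2.le⟩ (Ioo_subset_Icc_self hs) (Ioo_subset_Icc_self hs') hlt.le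
    · rw [hE.F_eq_zero (Ioo_subset_Icc_self hs) h, hE.F_eq_zero (Ioo_subset_Icc_self hs') h]
  -- Raising the threshold from s to s' adds ∫_s^s' (1 - F(v|t)) dt, positive because v is below
  -- `vhi`.
  have hW : s + (1 - s) * M.Fc v s < s' + (1 - s') * M.Fc v s' := by
    rw [one_sub_mul_Fc hs.2, one_sub_mul_Fc hs'.2,
      ← intervalIntegral.integral_add_adjacent_intervals (intervalIntegrable_F v s s')
        (intervalIntegrable_F v s' 1)]
    have hpos : 0 < ∫ t in s..s', (1 - M.F v t) :=
      intervalIntegral.intervalIntegral_pos_of_pos_on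
        (intervalIntegrable_const.sub (intervalIntegrable_F v s s'))
        (fun t ht => sub_pos.2 (hE.F_lt_one ⟨(hs.1.trans ht.1).le, (ht.2.trans hs'.2).le⟩ hv.2)) hlt
    rw [intervalIntegral.integral_sub intervalIntegrable_const (intervalIntegrable_F v s s')]
      at hpos
    simp at hpos
    linarith
  have hW0 : 0 ≤ s + (1 - s) * M.Fc v s :=
    add_nonneg hs.1.le (mul_nonneg (sub_pos.2 hs.2).le (Fc_mem_Icc hs.2 v).1)
  have hn : M.nbar - 1 ≠ 0 := by have := hE.two_le_nbar; omega
  have hF1 : 0 < 1 - M.F v s := sub_pos.2 (hE.F_lt_one (Ioo_subset_Icc_self hs) hv.2)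
  calc (1 - M.F v s) * (s + (1 - s) * M.Fc v s) ^ (M.nbar - 1)
      < (1 - M.F v s) * (s' + (1 - s') * M.Fc v s') ^ (M.nbar - 1) :=
        mul_lt_mul_of_pos_left (pow_lt_pow_left₀ hW hW0 hn) hF1
    _ ≤ (1 - M.F v s') * (s' + (1 - s') * M.Fc v s') ^ (M.nbar - 1) :=
        mul_le_mul_of_nonneg_right (by linarith) (pow_nonneg (hW0.trans hW.le) _)

/-- Otherwise F = 1 throughout the range of integration, and every cost would be 0. -/
theorem AssumptionE.vhi_pos (hE : M.AssumptionE Z) (hM : M.IsEquilibrium Z) : 0 < M.vhi := by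
  by_contra! hhi
  have h0 : ∀ z ∈ Z, M.cost z = 0 := by
    intro z hz
    rw [hM.break_even z hz, expectedProfit]
    have : ∀ v ∈ uIcc 0 M.vhi, (1 - M.F v (M.threshold z)) * (M.threshold z +
        (1 - M.threshold z) * M.Fc v (M.threshold z)) ^ (M.nbar - 1) = 0 := by
      intro v hv
      rw [uIcc_of_ge hhi] at hv
      rw [hE.F_eq_one (Ioo_subset_Icc_self (hM.threshold_mem z hz)) hv.1, sub_self, zero_mul]
    rw [intervalIntegral.integral_congr (g := fun _ => (0 : ℝ)) this]
    simp
  obtain ⟨z₁, h₁, z₂, h₂, hne⟩ := hE.cost_nonconstant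
  exact hne ((h0 z₁ h₁).trans (h0 z₂ h₂).symm)

/-- The intermediate value theorem is applied to the cost, then pulled back through the injective
profit; continuity of the threshold is not needed. -/
theorem IsEquilibrium.threshold_image_ordConnected (hE : M.AssumptionE Z)
    (hM : M.IsEquilibrium Z) : (M.threshold '' Z).OrdConnected := by
  have hmono := hE.expectedProfit_strictMonoOn (hE.vhi_pos hM)
  refine ⟨?_⟩
  rintro _ ⟨z₁, h₁, rfl⟩ _ ⟨z₂, h₂, rfl⟩ t ht
  have hs₁ := hM.threshold_mem z₁ h₁
  have hs₂ := hM.threshold_mem z₂ h₂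
  have htm : t ∈ Ioo (0 : ℝ) 1 := ⟨hs₁.1.trans_le ht.1, ht.2.trans_lt hs₂.2⟩
  have hle : M.expectedProfit t t ∈ Icc (M.cost z₁) (M.cost z₂) := by
    rw [hM.break_even z₁ h₁, hM.break_even z₂ h₂]
    exact ⟨hmono.monotoneOn hs₁ htm ht.1, hmono.monotoneOn htm hs₂ ht.2⟩
  obtain ⟨z, hz, hzt⟩ :=
    hE.Z_connected.isPreconnected.intermediate_value h₁ h₂ hE.cost_continuousOn hle
  rw [hM.break_even z hz] at hzt
  exact ⟨z, hz, hmono.injOn (hM.threshold_mem z hz) htm hzt⟩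

theorem IsEquilibrium.threshold_image_nontrivial (hE : M.AssumptionE Z)
    (hM : M.IsEquilibrium Z) : (M.threshold '' Z).Nontrivial := by
  obtain ⟨z₁, h₁, z₂, h₂, hne⟩ := hE.cost_nonconstant
  refine ⟨_, ⟨z₁, h₁, rfl⟩, _, ⟨z₂, h₂, rfl⟩, fun h => hne ?_⟩
  rw [hM.break_even z₁ h₁, hM.break_even z₂ h₂, h]

end Identification

end EntryModel

/-- A continuous function on `[a, b]` whose integrals up to `b` vanish from every point of a
nondegenerate interval vanishes on this interval. -/
theorem eqOn_zero_of_integral_eq_zero {g : ℝ → ℝ} {a b : ℝ} {I : Set ℝ}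
    (hg : ContinuousOn g (Icc a b)) (hI : I ⊆ Icc a b) (hord : I.OrdConnected)
    (hnt : I.Nontrivial) (h : ∀ s ∈ I, ∫ t in s..b, g t = 0) : EqOn g 0 I := by
  intro s hs
  have hab : a ≤ b := (hI hs).1.trans (hI hs).2
  set k : ℝ → ℝ := IccExtend hab (domRestrict (Icc a b) g) with hk
  have hkc : Continuous k := hg.domRestrict.Icc_extend'
  have hkg : ∀ x ∈ Icc a b, k x = g x := fun x hx => by
    rw [hk, IccExtend_of_mem _ _ hx, domRestrict_apply]
  have hzero : ∀ x ∈ I, ∫ t in x..b, k t = 0 := fun x hx => by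
    rw [← h x hx]
    refine intervalIntegral.integral_congr fun t ht => ?_
    rw [uIcc_of_le (hI hx).2] at ht
    exact hkg t ⟨(hI hx).1.trans ht.1, ht.2⟩
  obtain ⟨r, hr, hrs⟩ := hnt.exists_ne s
  have hd : HasDerivAt (fun x => ∫ t in x..b, k t) (-k s) s :=
    intervalIntegral.integral_hasDerivAt_left (hkc.intervalIntegrable _ _)
      hkc.stronglyMeasurable.stronglyMeasurableAtFilter hkc.continuousAt
  -- Differentiating within a segment contained in I also covers endpoints of I.
  have hd0 : HasDerivWithinAt (fun x => ∫ t in x..b, k t) 0 (uIcc s r) s :=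
    (hasDerivWithinAt_const s _ (0 : ℝ)).congr (fun x hx => hzero x (hord.uIcc_subset hs hr hx))
      (hzero s hs)
  have huniq : UniqueDiffWithinAt ℝ (uIcc s r) s :=
    uniqueDiffOn_Icc (by simpa using hrs) s left_mem_uIcc
  have := huniq.eq_deriv _ hd.hasDerivWithinAt hd0
  rw [neg_eq_zero, hkg s (hI hs)] at this
  exact this

/-! ### Recovery of F and of the cost. -/

namespace EntryModel

variable {d : ℕ} {M M' : EntryModel d} {Z : Set (EuclideanSpace ℝ (Fin d))}

theorem AssumptionE.F_continuousOn_right (hE : M.AssumptionE Z) {v : ℝ}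
    (hv : v ∈ Icc M.vlo M.vhi) : ContinuousOn (M.F v) (Icc 0 1) :=
  hE.F_continuousOn.comp (f := fun s => (v, s)) (by fun_prop) fun _ hs => ⟨hv, hs⟩

/-- Equality of the entrants' c.d.f.s makes the integral of F - F' from each threshold to 1 vanish;
inside the support this difference is continuous in the signal. -/
theorem SameOutcomes.F_eq (hE : M.AssumptionE Z) (hE' : M'.AssumptionE Z)
    (hM : M.IsEquilibrium Z) (hM' : M'.IsEquilibrium Z) (hobs : SameOutcomes M M' Z)
    (hn : M.nbar = M'.nbar) {s : ℝ} (hs : s ∈ M.threshold '' Z) (v : ℝ) :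
    M.F v s = M'.F v s := by
  have hI : M.threshold '' Z ⊆ Ioo 0 1 := by
    rintro _ ⟨z, hz, rfl⟩
    exact hM.threshold_mem z hz
  have hs01 := Ioo_subset_Icc_self (hI hs)
  obtain ⟨z₀, hz₀, -⟩ := id hs
  have hlo := hobs.vlo_eq hE hE' hM hM' hn hz₀
  have hhi := hobs.vhi_eq hE hE' hM hM' hn hz₀
  rcases le_total v M.vlo with h | h
  · rw [hE.F_eq_zero hs01 h, hE'.F_eq_zero hs01 (hlo ▸ h)]
  rcases le_total M.vhi v with h' | h'
  · rw [hE.F_eq_one hs01 h', hE'.F_eq_one hs01 (hhi ▸ h')]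
  have hcont : ContinuousOn (fun t => M.F v t - M'.F v t) (Icc 0 1) :=
    (hE.F_continuousOn_right ⟨h, h'⟩).sub (hE'.F_continuousOn_right ⟨hlo ▸ h, hhi ▸ h'⟩)
  refine sub_eq_zero.1 (eqOn_zero_of_integral_eq_zero hcont (hI.trans Ioo_subset_Icc_self)
    (hM.threshold_image_ordConnected hE) (hM.threshold_image_nontrivial hE) ?_ hs)
  rintro _ ⟨z, hz, rfl⟩
  have hz1 := (hM.threshold_mem z hz).2
  rw [intervalIntegral.integral_sub (intervalIntegrable_F _ _ _) (intervalIntegrable_F _ _ _),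
    ← one_sub_mul_Fc hz1, ← one_sub_mul_Fc hz1, hobs.Fc_eq hE hE' hM hM' hn hz, sub_self]

theorem SameOutcomes.cost_eq (hE : M.AssumptionE Z) (hE' : M'.AssumptionE Z)
    (hM : M.IsEquilibrium Z) (hM' : M'.IsEquilibrium Z) (hobs : SameOutcomes M M' Z)
    (hn : M.nbar = M'.nbar) {z : EuclideanSpace ℝ (Fin d)} (hz : z ∈ Z) :
    M.cost z = M'.cost z := by
  rw [hM.break_even z hz, hM'.break_even z hz, ← hobs.threshold_eq hE hM hM' hn hz,
    expectedProfit, expectedProfit, ← hn, hobs.vhi_eq hE hE' hM hM' hn hz]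
  refine intervalIntegral.integral_congr fun v _ => ?_
  simp only [hobs.F_eq hE hE' hM hM' hn ⟨z, hz, rfl⟩ v, hobs.Fc_eq hE hE' hM hM' hn hz v]

end EntryModel

theorem mainTheorem11 {d : ℕ} (Z : Set (EuclideanSpace ℝ (Fin d))) (M M' : EntryModel d)
    (hE : M.AssumptionE Z) (hE' : M'.AssumptionE Z)
    (hM : M.IsEquilibrium Z) (hM' : M'.IsEquilibrium Z)
    (hvar : ∃ z₁ ∈ Z, ∃ z₂ ∈ Z, M.bid z₁ 1 ≠ M.bid z₂ 1)
    (hobs : EntryModel.SameOutcomes M M' Z) :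
    M.nbar = M'.nbar ∧
    (∀ z ∈ Z, M.threshold z = M'.threshold z) ∧
    (∀ s ∈ M.threshold '' Z, ∀ v : ℝ, M.F v s = M'.F v s) ∧
    (∀ z ∈ Z, M.cost z = M'.cost z) := by
  have hn := hobs.nbar_eq hE hE' hM hM' hvar
  exact ⟨hn, fun _ hz => hobs.threshold_eq hE hM hM' hn hz,
    fun _ hs v => hobs.F_eq hE hE' hM hM' hn hs v, fun _ hz => hobs.cost_eq hE hE' hM hM' hn hz⟩
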